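/- For $x\in\mathbb R$ let $e(x)=e^{2\pi i x}$. For each integer $q\ge 1$ let $$\mathcal P_q=\Big\{x\mapsto\sum_{h\in H}e(hx)\;:\;H\subseteq\{0,1,\dots,q-1\}\Big\},$$ and for real $p>0$ put $$\gamma_p^\sharp(q)=\max_{R\in\mathcal P_q,\ R\ne 0}\ \frac{2\,|R(1/q)|^p}{\sum_{k=0}^{q-1}|R(k/q)|^p},\qquad \gamma_p^\sharp=\liminf_{q\to\infty}\gamma_p^\sharp(q).$$ **Theorem.** We have $\gamma_p^\sharp>0.483$ uniformly for all $p>2$: there is a constant $c>0.483$ such that $\gamma_p^\sharp\ge c$ for every real $p>2$. This holds both when $q$ runs through all positive integers in the limit inferior and when $q$ runs through the prime numbers only. -/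

import Mathlib

namespace IdempotentConcentration

noncomputable section

/-- The exponential `e(t) = exp(2πit)`. -/
def e (t : ℝ) : ℂ := Complex.exp (2 * Real.pi * Complex.I * t)

/-- The set `𝒫_q` of idempotents: the trigonometric polynomials
`x ↦ ∑_{h ∈ H} e(hx)` with `H ⊆ {0, …, q - 1}`. -/
def idempotents (q : ℕ) : Set (ℝ → ℂ) :=
  {R | ∃ H ⊆ Finset.range q, R = fun x : ℝ => ∑ h ∈ H, e (h * x)}

/-- The `p`-concentration of `R` at the point `1/q` of the grid `{k/q : 0 ≤ k < q}`. -/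
def concentrationRatio (p : ℝ) (q : ℕ) (R : ℝ → ℂ) : ℝ :=
  2 * ‖R (1 / q)‖ ^ p / ∑ k ∈ Finset.range q, ‖R (k / q)‖ ^ p

/-- `γ_p^♯(q)`: the supremum (a maximum, since `𝒫_q` is finite) of the concentration ratios of
the nonzero idempotents. The zero polynomial, whose ratio would be `0/0`, is left out. -/
def gammaSharpAt (p : ℝ) (q : ℕ) : ℝ :=
  sSup (concentrationRatio p q '' (idempotents q \ {0}))

/-- `γ_p^♯ = liminf_{q → ∞} γ_p^♯(q)`, over all positive integers `q`. The values
`γ_p^♯(q)` lie in `[0, 2]`, so the limit inferior can be taken in `ℝ`. -/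
def gammaSharp (p : ℝ) : ℝ :=
  Filter.liminf (fun q : ℕ => gammaSharpAt p q) Filter.atTop

/-- The variant of `γ_p^♯` in which `q` tends to infinity through the prime numbers only. -/
def gammaSharpPrime (p : ℝ) : ℝ :=
  Filter.liminf (fun q : ℕ => gammaSharpAt p q)
    (Filter.atTop ⊓ Filter.principal {q : ℕ | q.Prime})

end

end IdempotentConcentration

/-! ### Rounding a density to a set -/

namespace IdempotentConcentration

/-! Relax the set `H` to a density on `{0, …, q - 1}` with values in `[0, 1]`, sampled from a cosine
polynomial with even coefficients `a n ≥ 0`. Its Fourier coefficients on the grid are `q * a n`.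
Derandomized rounding gives a true set with every coefficient off by at most `η * q`. Since `p > 2`,
the `p`-th powers of these errors sum to at most `(η q)^(p-2)` times their `ℓ²` sum; Parseval bounds
the latter by `q ^ 2`, so the error is negligible. Hence any `c` strictly below `2 a₁^p / ∑ aₙ^p` is
eventually a lower bound (`eventually_le_gammaSharpAt`).

For `a n` take truncated, normalized Gaussian coefficients with `aₙ^p` proportional to `r^(n²)` for
`n ≠ 0`. Up to truncation the ratio becomes `2r / ∑ r^(n²)`, independent of `p`; `r = 3/5` gives
more than 0.4835. Only the threshold for `q` depends on `p`. -/

/-- A centred Bernoulli variable has mean zero, so the linear term of `exp x ≤ 1 + x + x ^ 2`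
cancels. -/
lemma bernoulli_exp_moment_le {f y : ℝ} (hf0 : 0 ≤ f) (hf1 : f ≤ 1) (hy : |y| ≤ 1) :
    f * Real.exp ((1 - f) * y) + (1 - f) * Real.exp ((0 - f) * y) ≤ Real.exp (y ^ 2) := by
  have key : ∀ x : ℝ, |x| ≤ 1 → Real.exp x ≤ 1 + x + x ^ 2 := fun x hx => by
    have := (abs_le.1 (Real.abs_exp_sub_one_sub_id_le hx)).2
    linarith
  have hb1 : |(1 - f) * y| ≤ 1 := by
    rw [abs_mul, abs_of_nonneg (by linarith : 0 ≤ 1 - f)]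
    exact mul_le_one₀ (by linarith) (abs_nonneg y) hy
  have hb2 : |(0 - f) * y| ≤ 1 := by
    rw [abs_mul, zero_sub, abs_neg, abs_of_nonneg hf0]
    exact mul_le_one₀ hf1 (abs_nonneg y) hy
  have h1 := mul_le_mul_of_nonneg_left (key _ hb1) hf0
  have h2 := mul_le_mul_of_nonneg_left (key _ hb2) (by linarith : 0 ≤ 1 - f)
  have h3 := Real.add_one_le_exp (y ^ 2)
  have h4 : 0 ≤ y ^ 2 * (1 - f * (1 - f)) := mul_nonneg (sq_nonneg y) (by nlinarith)
  nlinarith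

/-- Derandomized exponential moment bound for rounding the weights `f` to zeros and ones. -/
lemma exists_rounding {ι : Type*} (J : Finset ι) (c : ι → ℕ → ℝ) (f : ℕ → ℝ)
    (hf : ∀ h, 0 ≤ f h ∧ f h ≤ 1) (hc : ∀ j h, |c j h| ≤ 1) {t : ℝ} (ht0 : 0 ≤ t) (ht1 : t ≤ 1)
    (n : ℕ) : ∃ s : ℕ → ℝ, (∀ h, s h = 0 ∨ s h = 1) ∧
      ∑ j ∈ J, Real.exp (t * ∑ h ∈ Finset.range n, (s h - f h) * c j h)
        ≤ J.card * Real.exp (t ^ 2 * n) := by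
  induction n with
  | zero => exact ⟨fun _ => 0, fun _ => Or.inl rfl, by simp⟩
  | succ n ih =>
    obtain ⟨s, hs, hle⟩ := ih
    set W : ι → ℝ := fun j => Real.exp (t * ∑ h ∈ Finset.range n, (s h - f h) * c j h) with hW
    have hstep : ∀ b : ℝ, ∀ j, Real.exp (t * ∑ h ∈ Finset.range (n + 1),
        (Function.update s n b h - f h) * c j h) = W j * Real.exp ((b - f n) * (t * c j n)) := by
      intro b j
      have : ∑ h ∈ Finset.range n, (Function.update s n b h - f h) * c j h
          = ∑ h ∈ Finset.range n, (s h - f h) * c j h :=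
        Finset.sum_congr rfl fun h hh => by
          rw [Function.update_of_ne (Finset.mem_range.1 hh).ne]
      rw [Finset.sum_range_succ, this, Function.update_self, hW, ← Real.exp_add]
      congr 1
      ring
    have hsel : ∀ b : ℝ, (b = 0 ∨ b = 1) → ∀ h, Function.update s n b h = 0 ∨
        Function.update s n b h = 1 := by
      intro b hb h
      by_cases hh : h = n
      · subst hh; simpa using hb
      · simpa [Function.update_of_ne hh] using hs h
    have havg : f n * ∑ j ∈ J, W j * Real.exp ((1 - f n) * (t * c j n)) +
        (1 - f n) * ∑ j ∈ J, W j * Real.exp ((0 - f n) * (t * c j n))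
        ≤ J.card * Real.exp (t ^ 2 * ((n + 1 : ℕ) : ℝ)) := by
      rw [Finset.mul_sum, Finset.mul_sum, ← Finset.sum_add_distrib]
      calc _ ≤ ∑ j ∈ J, W j * Real.exp (t ^ 2) := by
            refine Finset.sum_le_sum fun j _ => ?_
            have hy : |t * c j n| ≤ 1 := by
              rw [abs_mul, abs_of_nonneg ht0]
              exact mul_le_one₀ ht1 (abs_nonneg _) (hc j n)
            have h1 := bernoulli_exp_moment_le (hf n).1 (hf n).2 hy
            have h2 : Real.exp ((t * c j n) ^ 2) ≤ Real.exp (t ^ 2) := by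
              apply Real.exp_le_exp.2
              rw [mul_pow, ← sq_abs (c j n)]
              exact mul_le_of_le_one_right (sq_nonneg t)
                (pow_le_one₀ (abs_nonneg _) (hc j n))
            have := mul_le_mul_of_nonneg_left (h1.trans h2) (Real.exp_pos (t * ∑ h ∈ Finset.range n, (s h - f h) * c j h)).le
            calc _ = _ := by ring
              _ ≤ _ := this
        _ = (∑ j ∈ J, W j) * Real.exp (t ^ 2) := by rw [Finset.sum_mul]
        _ ≤ J.card * Real.exp (t ^ 2 * n) * Real.exp (t ^ 2) :=
            mul_le_mul_of_nonneg_right hle (Real.exp_pos _).le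
        _ = _ := by
            rw [mul_assoc, ← Real.exp_add]
            push_cast
            ring_nf
    -- The `f n`-weighted average of the two choices meets the bound, so the smaller one does.
    rcases le_total (∑ j ∈ J, W j * Real.exp ((1 - f n) * (t * c j n)))
      (∑ j ∈ J, W j * Real.exp ((0 - f n) * (t * c j n))) with h | h
    · refine ⟨Function.update s n 1, hsel 1 (Or.inr rfl), ?_⟩
      simp only [hstep]
      nlinarith [(hf n).1, (hf n).2]
    · refine ⟨Function.update s n 0, hsel 0 (Or.inl rfl), ?_⟩
      simp only [hstep]
      nlinarith [(hf n).1, (hf n).2]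

lemma norm_e (t : ℝ) : ‖e t‖ = 1 := by
  have : e t = Complex.exp ((2 * Real.pi * t : ℝ) * Complex.I) := by
    rw [e]; push_cast; ring_nf
  rw [this, Complex.norm_exp_ofReal_mul_I]

/-- Rounding a density to the indicator of a set perturbs all Fourier coefficients by `o(q)`. -/
lemma eventually_exists_subset_fourier_close {η : ℝ} (hη0 : 0 < η) (hη1 : η ≤ 1) :
    ∀ᶠ q : ℕ in Filter.atTop, ∀ f : ℕ → ℝ, (∀ h, 0 ≤ f h ∧ f h ≤ 1) →
      ∃ H ⊆ Finset.range q, ∀ k ∈ Finset.range q,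
        ‖∑ h ∈ Finset.range q, (((if h ∈ H then 1 else 0 : ℝ) - f h : ℝ) : ℂ) *
          e (h * ((k : ℝ) / q))‖ ≤ η * q := by
  -- Real and imaginary parts will each be at most `2 * t * q`, together `η * q`.
  set t := η / 4 with ht
  have ht0 : 0 < t := by positivity
  have hlim : ∀ᶠ q : ℕ in Filter.atTop, 4 * (q : ℝ) ≤ Real.exp (t ^ 2 * q) := by
    have h1 := (isLittleO_pow_exp_pos_mul_atTop 1 (pow_pos ht0 2)).bound
      (by norm_num : (0 : ℝ) < 1 / 4)
    filter_upwards [tendsto_natCast_atTop_atTop.eventually h1] with q hq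
    simp only [pow_one, Real.norm_eq_abs, Real.abs_exp, Nat.abs_cast] at hq
    linarith
  filter_upwards [hlim] with q hq f hf
  -- Four directions at `q` frequencies give at most `4 * q` exponentials, a factor absorbed by `exp
  -- (t ^ 2 * q)`.
  set S : Finset ℂ := {1, -1, Complex.I, -Complex.I} with hS
  have hSn : ∀ w ∈ S, ‖w‖ = 1 := by
    intro w hw
    simp only [hS, Finset.mem_insert, Finset.mem_singleton] at hw
    rcases hw with rfl | rfl | rfl | rfl <;> simp
  have hScard : S.card ≤ 4 := Finset.card_le_four
  obtain ⟨s, hs, hsum⟩ := exists_rounding (Finset.univ : Finset (S × Fin q))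
    (fun j h => (j.1.1 * e (h * ((j.2.1 : ℝ) / q))).re) f hf
    (fun j h => (Complex.abs_re_le_norm _).trans (by
      rw [norm_mul, norm_e, hSn _ j.1.2, mul_one])) ht0.le (by linarith) q
  refine ⟨(Finset.range q).filter (fun h => s h = 1), Finset.filter_subset _ _, fun k hk => ?_⟩
  have hE : ∑ h ∈ Finset.range q, (((if h ∈ (Finset.range q).filter (fun h => s h = 1)
      then 1 else 0 : ℝ) - f h : ℝ) : ℂ) * e (h * ((k : ℝ) / q))
      = ∑ h ∈ Finset.range q, ((s h - f h : ℝ) : ℂ) * e (h * ((k : ℝ) / q)) := by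
    refine Finset.sum_congr rfl fun h hh => ?_
    rcases hs h with h0 | h0 <;> simp [Finset.mem_range.1 hh, h0]
  rw [hE]
  set E := ∑ h ∈ Finset.range q, ((s h - f h : ℝ) : ℂ) * e (h * ((k : ℝ) / q)) with hEd
  have hbound : ∀ w ∈ S, (w * E).re ≤ 2 * t * q := by
    intro w hw
    have h1 := (Finset.single_le_sum (fun j _ => (Real.exp_pos _).le)
      (Finset.mem_univ ((⟨w, hw⟩, ⟨k, Finset.mem_range.1 hk⟩) : S × Fin q))).trans hsum
    have h2 : ∑ h ∈ Finset.range q, (s h - f h) * (w * e (h * ((k : ℝ) / q))).re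
        = (w * E).re := by
      rw [hEd, Finset.mul_sum, Complex.re_sum]
      refine Finset.sum_congr rfl fun h _ => ?_
      rw [← Complex.re_ofReal_mul]
      ring_nf
    have h3 : ((Finset.univ : Finset (S × Fin q)).card : ℝ) ≤ 4 * q := by
      rw [Finset.card_univ, Fintype.card_prod, Fintype.card_fin, Fintype.card_coe]
      push_cast
      gcongr
      exact_mod_cast hScard
    simp only [h2] at h1
    have h4 : Real.exp (t * (w * E).re) ≤ Real.exp (t ^ 2 * q + t ^ 2 * q) := by
      rw [Real.exp_add]
      exact h1.trans (mul_le_mul_of_nonneg_right (h3.trans hq) (Real.exp_pos _).le)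
    have h5 : t * (w * E).re ≤ t * (2 * t * q) := by
      calc _ ≤ t ^ 2 * q + t ^ 2 * q := Real.exp_le_exp.1 h4
        _ = _ := by ring
    exact le_of_mul_le_mul_left h5 ht0
  have b1 := hbound 1 (by simp [hS])
  have b2 := hbound (-1) (by simp [hS])
  have b3 := hbound Complex.I (by simp [hS])
  have b4 := hbound (-Complex.I) (by simp [hS])
  simp at b1 b2 b3 b4
  have h6 : |E.re| ≤ 2 * t * q := abs_le.2 ⟨by linarith, b1⟩
  have h7 : |E.im| ≤ 2 * t * q := abs_le.2 ⟨by linarith, by linarith⟩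
  have := Complex.norm_le_abs_re_add_abs_im E
  have h8 : η * q = 4 * t * q := by rw [ht]; ring
  linarith

/-! ### Fourier analysis on the grid -/

lemma e_add (x y : ℝ) : e (x + y) = e x * e y := by
  rw [e, e, e, ← Complex.exp_add]; push_cast; ring_nf

lemma e_nat_mul (n : ℕ) (x : ℝ) : e (n * x) = e x ^ n := by
  rw [e, e, ← Complex.exp_nat_mul]; push_cast; ring_nf

lemma conj_e (x : ℝ) : (starRingEnd ℂ) (e x) = e (-x) := by
  rw [e, e, ← Complex.exp_conj]
  simp [Complex.conj_ofNat]

lemma e_eq_one_iff (x : ℝ) : e x = 1 ↔ ∃ n : ℤ, x = n := by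
  rw [e, Complex.exp_eq_one_iff]
  refine exists_congr fun n => ?_
  have h : (2 * Real.pi * Complex.I : ℂ) ≠ 0 := Complex.two_pi_I_ne_zero
  rw [mul_comm (n : ℂ), mul_right_inj' h]
  exact_mod_cast Iff.rfl

lemma e_eq_cos_add_sin (x : ℝ) :
    e x = Complex.mk (Real.cos (2 * Real.pi * x)) (Real.sin (2 * Real.pi * x)) := by
  have : e x = Complex.exp ((2 * Real.pi * x : ℝ) * Complex.I) := by
    rw [e]; push_cast; ring_nf
  rw [this]
  apply Complex.ext
  · exact Complex.exp_ofReal_mul_I_re _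
  · exact Complex.exp_ofReal_mul_I_im _

lemma sum_e_int_mul_div (q : ℕ) (hq : 0 < q) (m : ℤ) :
    ∑ k ∈ Finset.range q, e (m * ((k : ℝ) / q)) = if (q : ℤ) ∣ m then (q : ℂ) else 0 := by
  have hq' : (q : ℝ) ≠ 0 := by positivity
  have h1 : ∀ k : ℕ, e (m * ((k : ℝ) / q)) = e ((m : ℝ) / q) ^ k := fun k => by
    rw [← e_nat_mul]; ring_nf
  simp only [h1]
  have h2 : e ((m : ℝ) / q) = 1 ↔ (q : ℤ) ∣ m := by
    rw [e_eq_one_iff]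
    refine exists_congr fun n => ?_
    rw [div_eq_iff hq', mul_comm]
    exact_mod_cast Iff.rfl
  split_ifs with h
  · simp [h2.2 h]
  · rw [geom_sum_eq (fun h' => h (h2.1 h')), ← e_nat_mul, mul_div_cancel₀ _ hq',
      (e_eq_one_iff _).2 ⟨m, rfl⟩]
    simp

lemma sum_norm_sq_fourier (q : ℕ) (hq : 0 < q) (g : ℕ → ℝ) :
    ∑ k ∈ Finset.range q, ‖∑ h ∈ Finset.range q, (g h : ℂ) * e (h * ((k : ℝ) / q))‖ ^ 2
      = q * ∑ h ∈ Finset.range q, g h ^ 2 := by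
  have hnorm : ∀ z : ℂ, ((‖z‖ ^ 2 : ℝ) : ℂ) = z * (starRingEnd ℂ) z := fun z => by
    rw [Complex.mul_conj, Complex.normSq_eq_norm_sq]
  have hterm : ∀ k h h' : ℕ, (g h : ℂ) * e (h * ((k : ℝ) / q)) *
      (starRingEnd ℂ) ((g h' : ℂ) * e (h' * ((k : ℝ) / q)))
      = (g h : ℂ) * g h' * e (((h - h' : ℤ) : ℝ) * ((k : ℝ) / q)) := by
    intro k h h'
    rw [map_mul, conj_e, Complex.conj_ofReal]
    have : ((h - h' : ℤ) : ℝ) * ((k : ℝ) / q) = h * ((k : ℝ) / q) + -(h' * ((k : ℝ) / q)) := by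
      push_cast; ring
    rw [this, e_add]
    ring
  have : ((∑ k ∈ Finset.range q, ‖∑ h ∈ Finset.range q,
      (g h : ℂ) * e (h * ((k : ℝ) / q))‖ ^ 2 : ℝ) : ℂ)
      = ((q * ∑ h ∈ Finset.range q, g h ^ 2 : ℝ) : ℂ) := by
    push_cast
    simp only [← Complex.ofReal_pow, hnorm, map_sum, Finset.sum_mul_sum, hterm]
    rw [Finset.sum_comm, Finset.mul_sum]
    refine Finset.sum_congr rfl fun h hh => ?_
    rw [Finset.sum_comm]
    simp only [← Finset.mul_sum, sum_e_int_mul_div q hq]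
    rw [Finset.sum_eq_single_of_mem h hh]
    · simp; ring
    · intro h' hh' hne
      rw [if_neg, mul_zero]
      intro hd
      have h1 := Finset.mem_range.1 hh
      have h2 := Finset.mem_range.1 hh'
      have := Int.eq_zero_of_abs_lt_dvd hd (by rw [abs_lt]; omega)
      omega
  exact_mod_cast this

lemma sum_cos_eq_sum_e (N : ℕ) (a : ℤ → ℝ) (ha : ∀ n, a (-n) = a n) (x : ℝ) :
    ((∑ n ∈ Finset.Icc (-N : ℤ) N, a n * Real.cos (2 * Real.pi * (n * x)) : ℝ) : ℂ)
      = ∑ n ∈ Finset.Icc (-N : ℤ) N, (a n : ℂ) * e (n * x) := by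
  have hodd : ∑ n ∈ Finset.Icc (-N : ℤ) N, a n * Real.sin (2 * Real.pi * (n * x)) = 0 := by
    have h : ∑ n ∈ Finset.Icc (-N : ℤ) N, a n * Real.sin (2 * Real.pi * (n * x))
        = ∑ n ∈ Finset.Icc (-N : ℤ) N, -(a n * Real.sin (2 * Real.pi * (n * x))) := by
      refine Finset.sum_equiv (Equiv.neg ℤ) (fun n => ?_) (fun n _ => ?_)
      · simp only [Equiv.neg_apply, Finset.mem_Icc]; omega
      · simp only [Equiv.neg_apply, ha, Int.cast_neg, neg_mul, mul_neg, Real.sin_neg, neg_neg]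
    rw [Finset.sum_neg_distrib] at h
    linarith
  apply Complex.ext
  · rw [Complex.ofReal_re, Complex.re_sum]
    simp [e_eq_cos_add_sin, -Complex.ofReal_cos]
  · rw [Complex.ofReal_im, Complex.im_sum, ← hodd]
    simp [e_eq_cos_add_sin]

lemma fourier_sum_cos (q : ℕ) (hq : 0 < q) (N : ℕ) (a : ℤ → ℝ) (ha : ∀ n, a (-n) = a n) (k : ℕ) :
    ∑ h ∈ Finset.range q, ((∑ n ∈ Finset.Icc (-N : ℤ) N,
        a n * Real.cos (2 * Real.pi * (n * ((h : ℝ) / q))) : ℝ) : ℂ) * e (h * ((k : ℝ) / q))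
      = q * ∑ n ∈ Finset.Icc (-N : ℤ) N, if (q : ℤ) ∣ n + k then (a n : ℂ) else 0 := by
  simp only [sum_cos_eq_sum_e N a ha, Finset.sum_mul]
  rw [Finset.sum_comm, Finset.mul_sum]
  refine Finset.sum_congr rfl fun n _ => ?_
  have h1 : ∀ h : ℕ, (a n : ℂ) * e (n * ((h : ℝ) / q)) * e (h * ((k : ℝ) / q))
      = a n * e ((n + k : ℤ) * ((h : ℝ) / q)) := fun h => by
    rw [mul_assoc, ← e_add]; push_cast; ring_nf
  simp only [h1, ← Finset.mul_sum, sum_e_int_mul_div q hq]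
  split_ifs <;> simp [mul_comm]

/-! ### Transfer from densities to idempotents -/

lemma bddAbove_concentrationRatio (p : ℝ) (q : ℕ) :
    BddAbove (concentrationRatio p q '' (idempotents q \ {0})) := by
  refine (Set.Finite.image _ (Set.Finite.subset ?_ Set.sdiff_subset)).bddAbove
  have : idempotents q = (fun (H : Finset ℕ) (x : ℝ) => ∑ h ∈ H, e (h * x)) ''
      ((Finset.range q).powerset : Set (Finset ℕ)) := by
    ext R
    simp only [idempotents, Set.mem_ofPred_eq, Set.mem_image, Finset.mem_coe,
      Finset.mem_powerset, eq_comm]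
  rw [this]
  exact (Finset.finite_toSet _).image _

lemma gammaSharpAt_le_two (p : ℝ) {q : ℕ} (hq : 2 ≤ q) : gammaSharpAt p q ≤ 2 := by
  refine Real.sSup_le ?_ zero_le_two
  rintro _ ⟨R, -, rfl⟩
  have h0 : ∀ k ∈ Finset.range q, 0 ≤ ‖R ((k : ℝ) / q)‖ ^ p :=
    fun k _ => Real.rpow_nonneg (norm_nonneg _) _
  have h1 := Finset.single_le_sum h0 (Finset.mem_range.2 (by omega : 1 < q))
  rw [Nat.cast_one] at h1
  exact div_le_of_le_mul₀ (Finset.sum_nonneg h0) zero_le_two (by linarith)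

lemma le_liminf_gammaSharpAt {p c : ℝ} {l : Filter ℕ} [l.NeBot] (hl : l ≤ Filter.atTop)
    (h : ∀ᶠ q : ℕ in Filter.atTop, c ≤ gammaSharpAt p q) :
    c ≤ Filter.liminf (fun q : ℕ => gammaSharpAt p q) l := by
  refine Filter.le_liminf_of_le ?_ (hl h)
  refine Filter.IsBoundedUnder.isCoboundedUnder_ge ⟨2, ?_⟩
  rw [Filter.eventually_map]
  exact hl ((Filter.eventually_ge_atTop 2).mono fun q hq => gammaSharpAt_le_two p hq)

/-- Both sides are continuous in `η` at 0, where `p > 2` makes `η ^ (p - 2)` vanish. -/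
lemma exists_small_perturbation {p : ℝ} (hp : 2 < p) (S : Finset ℤ) (a : ℤ → ℝ) {c : ℝ}
    (ha1 : 0 < a 1) (hc : c * ∑ n ∈ S, a n ^ p < 2 * a 1 ^ p) :
    ∃ η : ℝ, 0 < η ∧ η ≤ 1 ∧ η < a 1 ∧
      c * (∑ n ∈ S, (a n + η) ^ p + η ^ (p - 2)) < 2 * (a 1 - η) ^ p := by
  have hL : ContinuousAt (fun η : ℝ => c * (∑ n ∈ S, (a n + η) ^ p + η ^ (p - 2))) 0 := by
    refine ContinuousAt.mul continuousAt_const (ContinuousAt.add ?_ ?_)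
    · exact tendsto_finsetSum S fun n _ =>
        ContinuousAt.rpow_const (by fun_prop) (Or.inr (by linarith))
    · exact ContinuousAt.rpow_const continuousAt_id (Or.inr (by linarith))
  have hR : ContinuousAt (fun η : ℝ => 2 * (a 1 - η) ^ p) 0 :=
    ContinuousAt.mul continuousAt_const
      (ContinuousAt.rpow_const (by fun_prop) (Or.inr (by linarith)))
  have hlt := hL.eventually_lt hR (by
    simpa [Real.zero_rpow (by linarith : p - 2 ≠ 0)] using hc)
  have h1 := (hlt.filter_mono nhdsWithin_le_nhds).and
    (Ioo_mem_nhdsGT (lt_min one_pos ha1) : Set.Ioo 0 (min 1 (a 1)) ∈ nhdsWithin 0 (Set.Ioi 0))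
  obtain ⟨η, h2, h3, h4⟩ := h1.exists
  exact ⟨η, h3, (h4.trans_le (min_le_left _ _)).le, h4.trans_le (min_le_right _ _), h2⟩

/-- For `q > 2N` a class modulo `q` has at most one representative in `[-N, N]`. -/
lemma eq_of_dvd_add_of_mem_Icc {q N : ℕ} (hq : 2 * N < q) {n m : ℤ}
    (hn : n ∈ Finset.Icc (-N : ℤ) N) (hm : m ∈ Finset.Icc (-N : ℤ) N) {k : ℤ}
    (h1 : (q : ℤ) ∣ n + k) (h2 : (q : ℤ) ∣ m + k) : n = m := by
  rw [Finset.mem_Icc] at hn hm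
  have h3 : (q : ℤ) ∣ n - m := by simpa using dvd_sub h1 h2
  have := Int.eq_zero_of_abs_lt_dvd h3 (by rw [abs_lt]; omega)
  omega

lemma sum_range_ite_dvd_le (q : ℕ) (n : ℤ) {b : ℝ} (hb : 0 ≤ b) :
    ∑ k ∈ Finset.range q, (if (q : ℤ) ∣ n + (k : ℤ) then b else 0) ≤ b := by
  rw [← Finset.sum_filter, Finset.sum_const, nsmul_eq_mul]
  refine mul_le_of_le_one_left hb ?_
  exact_mod_cast Finset.card_le_one.2 fun k hk l hl => by
    simp only [Finset.mem_filter, Finset.mem_range] at hk hl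
    have h3 : (q : ℤ) ∣ (k : ℤ) - l := by simpa using dvd_sub hk.2 hl.2
    have := Int.eq_zero_of_abs_lt_dvd h3 (by rw [abs_lt]; omega)
    omega

/-- A trigonometric polynomial `∑ a_n e(nx)` with values in `[0, 1]` bounds the concentration
constants from below for `p > 2`. -/
lemma eventually_le_gammaSharpAt {p : ℝ} (hp : 2 < p) {N : ℕ} (hN : 1 ≤ N) (a : ℤ → ℝ)
    (ha : ∀ n, a (-n) = a n) (ha0 : ∀ n, 0 ≤ a n) (ha1 : 0 < a 1)
    (hf : ∀ x : ℝ, 0 ≤ ∑ n ∈ Finset.Icc (-N : ℤ) N, a n * Real.cos (2 * Real.pi * (n * x)) ∧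
      ∑ n ∈ Finset.Icc (-N : ℤ) N, a n * Real.cos (2 * Real.pi * (n * x)) ≤ 1)
    {c : ℝ} (hc0 : 0 ≤ c) (hc : c * ∑ n ∈ Finset.Icc (-N : ℤ) N, a n ^ p < 2 * a 1 ^ p) :
    ∀ᶠ q : ℕ in Filter.atTop, c ≤ gammaSharpAt p q := by
  obtain ⟨η, hη0, hη1, hηa, hη⟩ := exists_small_perturbation hp _ a ha1 hc
  filter_upwards [eventually_exists_subset_fourier_close hη0 hη1,
    Filter.eventually_gt_atTop (2 * N)] with q hH hqN
  have hq0 : 0 < q := by omega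
  have hqR : (0 : ℝ) < q := by exact_mod_cast hq0
  set f : ℕ → ℝ := fun h => ∑ n ∈ Finset.Icc (-N : ℤ) N,
    a n * Real.cos (2 * Real.pi * (n * ((h : ℝ) / q))) with hfd
  obtain ⟨H, hHq, hE⟩ := hH f fun h => hf _
  set g : ℕ → ℝ := fun h => (if h ∈ H then 1 else 0 : ℝ) - f h with hg
  set E : ℕ → ℂ := fun k => ∑ h ∈ Finset.range q, (g h : ℂ) * e (h * ((k : ℝ) / q)) with hEd
  set F : ℕ → ℝ := fun k => ∑ n ∈ Finset.Icc (-N : ℤ) N,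
    if (q : ℤ) ∣ n + (k : ℤ) then a n else 0 with hFd
  set R : ℝ → ℂ := fun x => ∑ h ∈ H, e (h * x) with hRd
  have hE' : ∀ k ∈ Finset.range q, ‖E k‖ ≤ η * q := hE
  have hR : ∀ k : ℕ, R ((k : ℝ) / q) = ((q * F k : ℝ) : ℂ) + E k := by
    intro k
    have h1 : ((q * F k : ℝ) : ℂ)
        = ∑ h ∈ Finset.range q, (f h : ℂ) * e (h * ((k : ℝ) / q)) := by
      rw [fourier_sum_cos q hq0 N a ha k, hFd]
      push_cast
      simp only [apply_ite Complex.ofReal, Complex.ofReal_zero]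
    rw [h1, hEd, ← Finset.sum_add_distrib, hRd]
    have h2 : ∀ h, (f h : ℂ) * e (h * ((k : ℝ) / q)) + (g h : ℂ) * e (h * ((k : ℝ) / q))
        = if h ∈ H then e (h * ((k : ℝ) / q)) else 0 := by
      intro h
      rw [← add_mul, ← Complex.ofReal_add, hg, add_sub_cancel]
      split_ifs <;> simp
    simp only [h2]
    rw [Finset.sum_ite_mem, Finset.inter_eq_right.2 hHq]
  have hFeq : ∀ (k : ℕ) (n : ℤ), n ∈ Finset.Icc (-N : ℤ) N → (q : ℤ) ∣ n + (k : ℤ) →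
      F k = a n := by
    intro k n hn hd
    rw [hFd]
    refine (Finset.sum_eq_single_of_mem n hn fun m hm hne => if_neg fun hd' => hne ?_).trans
      (if_pos hd)
    exact eq_of_dvd_add_of_mem_Icc hqN hm hn hd' hd
  have hterm : ∀ k ∈ Finset.range q, ‖R ((k : ℝ) / q)‖ ^ p ≤
      (q : ℝ) ^ p * (∑ n ∈ Finset.Icc (-N : ℤ) N,
        if (q : ℤ) ∣ n + (k : ℤ) then (a n + η) ^ p else 0)
      + (η * q) ^ (p - 2) * ‖E k‖ ^ 2 := by
    intro k hk
    have hs0 : ∀ n ∈ Finset.Icc (-N : ℤ) N,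
        (0 : ℝ) ≤ if (q : ℤ) ∣ n + (k : ℤ) then (a n + η) ^ p else 0 := by
      intro n _
      split_ifs
      · exact Real.rpow_nonneg (add_nonneg (ha0 n) hη0.le) _
      · exact le_rfl
    -- On the spectrum of the density the error is absorbed into `a n + η`; off it only `E k`
    -- remains, and `p - 2` of its powers are bounded uniformly.
    by_cases hex : ∃ n ∈ Finset.Icc (-N : ℤ) N, (q : ℤ) ∣ n + (k : ℤ)
    · obtain ⟨n, hn, hd⟩ := hex
      have h1 : ‖R ((k : ℝ) / q)‖ ≤ q * (a n + η) := by
        rw [hR, hFeq k n hn hd]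
        refine (norm_add_le _ _).trans ?_
        rw [Complex.norm_of_nonneg (mul_nonneg hqR.le (ha0 n))]
        linarith [hE' k hk]
      have h2 : ‖R ((k : ℝ) / q)‖ ^ p ≤ (q : ℝ) ^ p * (a n + η) ^ p := by
        rw [← Real.mul_rpow hqR.le (add_nonneg (ha0 n) hη0.le)]
        exact Real.rpow_le_rpow (norm_nonneg _) h1 (by linarith)
      have h3 := Finset.single_le_sum hs0 hn
      rw [if_pos hd] at h3
      have h4 := mul_le_mul_of_nonneg_left h3 (Real.rpow_nonneg hqR.le p)
      have h5 : 0 ≤ (η * q) ^ (p - 2) * ‖E k‖ ^ 2 := by positivity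
      linarith
    · have hF0 : F k = 0 := Finset.sum_eq_zero fun n hn => if_neg fun hd => hex ⟨n, hn, hd⟩
      have h1 : ‖R ((k : ℝ) / q)‖ = ‖E k‖ := by rw [hR, hF0]; simp
      rw [h1]
      have h2 : ‖E k‖ ^ p = ‖E k‖ ^ (p - 2) * ‖E k‖ ^ 2 := by
        rw [← Real.rpow_natCast, ← Real.rpow_add_of_nonneg (norm_nonneg _) (by linarith)
          (by norm_num)]
        norm_num
      rw [h2]
      have h3 := mul_le_mul_of_nonneg_right (Real.rpow_le_rpow (norm_nonneg _) (hE' k hk)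
        (by linarith : 0 ≤ p - 2)) (sq_nonneg ‖E k‖)
      have h4 := mul_nonneg (Real.rpow_nonneg hqR.le p) (Finset.sum_nonneg hs0)
      linarith
  have hEsum : ∑ k ∈ Finset.range q, ‖E k‖ ^ 2 ≤ (q : ℝ) ^ 2 := by
    rw [hEd, sum_norm_sq_fourier q hq0 g, sq]
    refine mul_le_mul_of_nonneg_left ?_ hqR.le
    calc _ ≤ ∑ h ∈ Finset.range q, (1 : ℝ) := by
          refine Finset.sum_le_sum fun h _ => ?_
          have h1 : 0 ≤ f h ∧ f h ≤ 1 := hf _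
          simp only [hg]
          split_ifs <;> nlinarith
      _ = q := by simp
  have hD : ∑ k ∈ Finset.range q, ‖R ((k : ℝ) / q)‖ ^ p ≤
      (q : ℝ) ^ p * (∑ n ∈ Finset.Icc (-N : ℤ) N, (a n + η) ^ p + η ^ (p - 2)) := by
    refine (Finset.sum_le_sum hterm).trans ?_
    rw [Finset.sum_add_distrib, ← Finset.mul_sum, ← Finset.mul_sum, Finset.sum_comm, mul_add]
    refine add_le_add (mul_le_mul_of_nonneg_left (Finset.sum_le_sum fun n _ =>
      sum_range_ite_dvd_le q n (Real.rpow_nonneg (add_nonneg (ha0 n) hη0.le) _))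
      (Real.rpow_nonneg hqR.le p)) ?_
    refine (mul_le_mul_of_nonneg_left hEsum (Real.rpow_nonneg (by positivity) _)).trans ?_
    rw [Real.mul_rpow hη0.le hqR.le, mul_assoc, ← Real.rpow_natCast, ← Real.rpow_add hqR]
    norm_num [mul_comm]
  have hR1 : q * (a 1 - η) ≤ ‖R (1 / q)‖ := by
    have h1 := hR 1
    rw [Nat.cast_one, hFeq 1 (-1) (by simp; omega) (by simp), ha] at h1
    have h2 := norm_sub_norm_le (((q * a 1 : ℝ)) : ℂ) (-E 1)
    rw [sub_neg_eq_add, ← h1, norm_neg, Complex.norm_of_nonneg (mul_nonneg hqR.le ha1.le)] at h2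
    linarith [hE' 1 (Finset.mem_range.2 (by omega))]
  have hR1pos : 0 < ‖R (1 / q)‖ := (mul_pos hqR (by linarith)).trans_le hR1
  have hmem : concentrationRatio p q R ∈ concentrationRatio p q '' (idempotents q \ {0}) := by
    refine ⟨R, ⟨⟨H, hHq, rfl⟩, fun h => ?_⟩, rfl⟩
    rw [Set.mem_singleton_iff] at h
    rw [h] at hR1pos
    simp at hR1pos
  refine le_trans ?_ (le_csSup (bddAbove_concentrationRatio p q) hmem)
  have hDpos : 0 < ∑ k ∈ Finset.range q, ‖R ((k : ℝ) / q)‖ ^ p := by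
    have h1 := Finset.single_le_sum (f := fun k : ℕ => ‖R ((k : ℝ) / q)‖ ^ p)
      (fun k _ => Real.rpow_nonneg (norm_nonneg _) _) (Finset.mem_range.2 (by omega : 1 < q))
    rw [Nat.cast_one] at h1
    exact (Real.rpow_pos_of_pos hR1pos p).trans_le h1
  rw [concentrationRatio, le_div_iff₀ hDpos]
  calc _ ≤ c * ((q : ℝ) ^ p * (∑ n ∈ Finset.Icc (-N : ℤ) N, (a n + η) ^ p + η ^ (p - 2))) :=
        mul_le_mul_of_nonneg_left hD hc0
    _ = (q : ℝ) ^ p * (c * (∑ n ∈ Finset.Icc (-N : ℤ) N, (a n + η) ^ p + η ^ (p - 2))) := by ring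
    _ ≤ (q : ℝ) ^ p * (2 * (a 1 - η) ^ p) :=
        mul_le_mul_of_nonneg_left hη.le (Real.rpow_nonneg hqR.le p)
    _ = 2 * (q * (a 1 - η)) ^ p := by
        rw [Real.mul_rpow hqR.le (by linarith)]; ring
    _ ≤ 2 * ‖R (1 / q)‖ ^ p := by
        have := Real.rpow_le_rpow (mul_nonneg hqR.le (by linarith)) hR1 (by linarith : 0 ≤ p)
        linarith

/-! ### Gaussian coefficients -/

lemma hasSum_gaussian_mul_cos (x : ℝ) {t : ℝ} (ht : 0 < t) :
    HasSum (fun n : ℤ => Real.exp (-Real.pi * n ^ 2 * t) * Real.cos (2 * Real.pi * (n * x)))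
      (HurwitzZeta.cosKernel x t) := by
  have h := Complex.hasSum_re (HurwitzZeta.hasSum_int_cosKernel x ht)
  rw [Complex.ofReal_re] at h
  convert h using 2 with n
  have h1 : (2 * Real.pi * Complex.I * x * n : ℂ) = ((2 * Real.pi * (n * x) : ℝ) : ℂ) * Complex.I := by
    push_cast; ring
  rw [Complex.re_mul_ofReal, h1, Complex.exp_ofReal_mul_I_re, mul_comm]

/-- Poisson summation turns the cosine series into a sum of positive Gaussians. -/
lemma cosKernel_nonneg (x : ℝ) {t : ℝ} (ht : 0 < t) : 0 ≤ HurwitzZeta.cosKernel x t := by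
  have h1 := HurwitzZeta.evenKernel_functional_equation x (1 / t)
  rw [one_div_one_div] at h1
  have h2 : 0 ≤ HurwitzZeta.evenKernel x (1 / t) :=
    (HurwitzZeta.hasSum_int_evenKernel x (one_div_pos.2 ht)).nonneg fun n => (Real.exp_pos _).le
  rw [h1] at h2
  exact nonneg_of_mul_nonneg_right h2 (by positivity)

/-- Three explicit terms, then a geometric tail from `(i + 4) ^ 2 ≥ 16 + i`. -/
lemma sum_pow_sq_le (N : ℕ) : ∑ i ∈ Finset.range N, (3 / 5 : ℝ) ^ ((i + 1) ^ 2) ≤ 0.7404 := by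
  have h1 : ∑ i ∈ Finset.range N, (3 / 5 : ℝ) ^ ((i + 1) ^ 2)
      ≤ ∑ i ∈ Finset.range (N + 3), (3 / 5 : ℝ) ^ ((i + 1) ^ 2) :=
    Finset.sum_le_sum_of_subset_of_nonneg (Finset.range_mono (by omega))
      fun _ _ _ => by positivity
  have h2 : ∑ i ∈ Finset.range N, (3 / 5 : ℝ) ^ ((i + 1 + 1 + 1 + 1) ^ 2)
      ≤ ∑ i ∈ Finset.range N, (3 / 5 : ℝ) ^ 16 * (3 / 5) ^ i := by
    refine Finset.sum_le_sum fun i _ => ?_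
    rw [← pow_add]
    exact pow_le_pow_of_le_one (by norm_num) (by norm_num) (by nlinarith)
  have h3 : ∑ i ∈ Finset.range N, (3 / 5 : ℝ) ^ i ≤ 5 / 2 := by
    rw [geom_sum_eq (by norm_num)]
    have : (0 : ℝ) ≤ (3 / 5) ^ N := by positivity
    rw [div_le_iff_of_neg (by norm_num)]
    linarith
  rw [← Finset.mul_sum] at h2
  rw [Finset.sum_range_succ', Finset.sum_range_succ', Finset.sum_range_succ'] at h1
  norm_num at h1 h2 h3 ⊢
  linarith

lemma sum_Icc_neg_of_even (g : ℤ → ℝ) (hg : ∀ n, g (-n) = g n) (N : ℕ) :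
    ∑ n ∈ Finset.Icc (-N : ℤ) N, g n = g 0 + 2 * ∑ i ∈ Finset.range N, g (i + 1) := by
  induction N with
  | zero => simp
  | succ N ih =>
    have : Finset.Icc (-(N + 1 : ℕ) : ℤ) (N + 1 : ℕ)
        = insert (N + 1 : ℤ) (insert (-(N + 1 : ℤ)) (Finset.Icc (-N : ℤ) N)) := by
      ext n; simp only [Finset.mem_Icc, Finset.mem_insert]; omega
    rw [this, Finset.sum_insert (by simp; omega), Finset.sum_insert (by simp), ih, hg,
      Finset.sum_range_succ]
    ring

lemma tendsto_sum_Icc_neg {b : ℤ → ℝ} (hb : Summable b) :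
    Filter.Tendsto (fun N : ℕ => ∑ n ∈ Finset.Icc (-N : ℤ) N, b n) Filter.atTop
      (nhds (∑' n, b n)) := by
  refine hb.hasSum.comp (Filter.tendsto_atTop_finset_of_monotone ?_ fun n => ⟨n.natAbs, ?_⟩)
  · intro N M h
    exact Finset.Icc_subset_Icc (by omega) (by omega)
  · rw [Finset.mem_Icc]; omega

lemma eventually_le_gammaSharpAt_gaussian {p : ℝ} (hp : 2 < p) :
    ∀ᶠ q : ℕ in Filter.atTop, 0.4835 ≤ gammaSharpAt p q := by
  have hp0 : 0 < p := by linarith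
  -- Chosen so that `b n ^ p = (3 / 5) ^ (n ^ 2)`; 3/5 is close to the maximizer of `2r / ∑ r^(n²)`.
  set t : ℝ := Real.log (5 / 3) / (Real.pi * p) with htd
  have ht : 0 < t := div_pos (Real.log_pos (by norm_num)) (by positivity)
  set b : ℤ → ℝ := fun n => Real.exp (-Real.pi * n ^ 2 * t) with hbd
  have hb0 : ∀ n, 0 < b n := fun n => Real.exp_pos _
  have hbz : b 0 = 1 := by simp [hbd]
  have hbneg : ∀ n, b (-n) = b n := fun n => by simp [hbd]
  have hbp : ∀ n : ℤ, b n ^ p = (3 / 5 : ℝ) ^ (n.natAbs ^ 2) := by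
    intro n
    have h1 : (3 / 5 : ℝ) = Real.exp (-Real.log (5 / 3)) := by
      rw [Real.exp_neg, Real.exp_log (by norm_num)]; norm_num
    have h2 : ((n.natAbs ^ 2 : ℕ) : ℝ) = (n : ℝ) ^ 2 := by
      rw [← Int.cast_natCast]; push_cast; rw [sq_abs]
    rw [hbd, ← Real.exp_mul, h1, ← Real.exp_nat_mul, h2, htd]
    congr 1
    field_simp
  have hbs : Summable b := by
    have := (hasSum_gaussian_mul_cos 0 ht).summable
    simpa [hbd] using this
  set T := ∑' n, b n with hT
  have hTlim := tendsto_sum_Icc_neg hbs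
  have hlim : Filter.Tendsto (fun N : ℕ => (1 + (T - ∑ n ∈ Finset.Icc (-N : ℤ) N, b n)) ^ p)
      Filter.atTop (nhds 1) := by
    have := ((hTlim.const_sub T).const_add 1).rpow_const (p := p) (Or.inr hp0.le)
    rwa [← hT, sub_self, add_zero, Real.one_rpow] at this
  obtain ⟨N, hN, hN1⟩ := ((hlim.eventually_lt_const (by norm_num : (1 : ℝ) < 1.001)).and
    (Filter.eventually_ge_atTop 1)).exists
  set S := Finset.Icc (-N : ℤ) N with hS
  have h0S : (0 : ℤ) ∈ S := by simp [hS]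
  set δ := T - ∑ n ∈ S, b n with hδ
  have hδ0 : 0 ≤ δ := sub_nonneg.2 (hbs.sum_le_tsum S fun n _ => (hb0 n).le)
  have hTpos : 0 < T := by
    have := Finset.single_le_sum (fun n _ => (hb0 n).le) h0S
    linarith [hb0 0]
  -- Moving the truncated mass `δ` to the constant term keeps the polynomial nonnegative and its
  -- value at 0 equal to `T`.
  set d : ℤ → ℝ := fun n => b n + if n = 0 then δ else 0 with hd
  have hd1 : d 1 = b 1 := by simp [hd]
  have hdge : ∀ n, 0 ≤ d n := fun n => by
    have := hb0 n
    simp only [hd]; split_ifs <;> linarith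
  have hdcos : ∀ x : ℝ, ∑ n ∈ S, d n * Real.cos (2 * Real.pi * (n * x))
      = ∑ n ∈ S, b n * Real.cos (2 * Real.pi * (n * x)) + δ := by
    intro x
    simp only [hd, add_mul, Finset.sum_add_distrib, ite_mul, zero_mul]
    rw [Finset.sum_ite_eq' S 0]
    simp [h0S]
  refine eventually_le_gammaSharpAt hp hN1 (fun n => T⁻¹ * d n) (fun n => ?_)
    (fun n => mul_nonneg (inv_nonneg.2 hTpos.le) (hdge n)) ?_ (fun x => ?_) (by norm_num) ?_
  · simp [hd, hbneg]
  · rw [hd1]; exact mul_pos (inv_pos.2 hTpos) (hb0 1)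
  · simp only [mul_assoc T⁻¹, ← Finset.mul_sum]
    rw [← hS, hdcos]
    have hcos := hasSum_gaussian_mul_cos x ht
    constructor
    · refine mul_nonneg (inv_nonneg.2 hTpos.le) ?_
      have h1 := (hbs.sub hcos.summable).sum_le_tsum S fun n _ =>
        sub_nonneg.2 (mul_le_of_le_one_right (hb0 n).le (Real.cos_le_one _))
      rw [hbs.tsum_sub hcos.summable, hcos.tsum_eq, Finset.sum_sub_distrib] at h1
      linarith [cosKernel_nonneg x ht]
    · rw [inv_mul_le_one₀ hTpos]
      have h1 : ∑ n ∈ S, b n * Real.cos (2 * Real.pi * (n * x)) ≤ ∑ n ∈ S, b n :=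
        Finset.sum_le_sum fun n _ => mul_le_of_le_one_right (hb0 n).le (Real.cos_le_one _)
      linarith
  · simp only [Real.mul_rpow (inv_nonneg.2 hTpos.le) (hdge _), ← Finset.mul_sum, hd1]
    have hTp : 0 < T⁻¹ ^ p := Real.rpow_pos_of_pos (inv_pos.2 hTpos) p
    have hsum : ∑ n ∈ S, d n ^ p ≤ 1.001 + 2 * 0.7404 := by
      rw [hS, sum_Icc_neg_of_even _ (fun n => by simp [hd, hbneg])]
      have h1 : d 0 ^ p ≤ 1.001 := by simpa [hd, hbz] using hN.le
      have h2 : ∑ i ∈ Finset.range N, d (i + 1) ^ p ≤ 0.7404 := by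
        refine le_of_eq_of_le (Finset.sum_congr rfl fun i _ => ?_) (sum_pow_sq_le N)
        have h3 : d (i + 1) = b (i + 1) := by
          have : (i : ℤ) + 1 ≠ 0 := by omega
          simp [hd, this]
        rw [h3, hbp]
        congr 1
      linarith
    -- Here `0.4835 * 2.4818` is just below 1.2.
    have : 0.4835 * ∑ n ∈ S, d n ^ p < 2 * (3 / 5) := by norm_num at hsum ⊢; linarith
    calc _ = T⁻¹ ^ p * (0.4835 * ∑ n ∈ S, d n ^ p) := by ring
      _ < T⁻¹ ^ p * (2 * (3 / 5)) := mul_lt_mul_of_pos_left this hTp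
      _ = _ := by
        rw [Real.mul_rpow (inv_nonneg.2 hTpos.le) (hb0 1).le, hbp]
        norm_num
        ring

end IdempotentConcentration

theorem theorem2p2 :
    ∃ c : ℝ, 0.483 < c ∧ ∀ p : ℝ, 2 < p →
      c ≤ IdempotentConcentration.gammaSharp p ∧
      c ≤ IdempotentConcentration.gammaSharpPrime p := by
  refine ⟨0.4835, by norm_num, fun p hp => ?_⟩
  have h := IdempotentConcentration.eventually_le_gammaSharpAt_gaussian hp
  have : (Filter.atTop ⊓ Filter.principal {q : ℕ | q.Prime}).NeBot :=
    Filter.inf_principal_neBot_iff.2 fun U hU => by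
      obtain ⟨n, hn⟩ := Filter.mem_atTop_sets.1 hU
      obtain ⟨q, hq, hqp⟩ := Nat.exists_infinite_primes n
      exact ⟨q, hn q hq, hqp⟩
  exact ⟨IdempotentConcentration.le_liminf_gammaSharpAt le_rfl h,
    IdempotentConcentration.le_liminf_gammaSharpAt inf_le_left h⟩
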